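/- \textbf{Setting.} Let $V$ be a finite-dimensional Euclidean space. Write elements of $\operatorname{Iso}(V)=\mathsf O(V)\ltimes V$ as pairs $(A,v)$, acting by $x\mapsto Ax+v$. A \emph{crystallographic group} of $V$ is a discrete subgroup of $\operatorname{Iso}(V)$ such that some compact subset of $V$ meets every orbit, and a \emph{Bieberbach group} is a torsion-free crystallographic group. For a subgroup $\Gamma\subset\operatorname{Iso}(V)$, the orbit space $V/\Gamma$ carries the quotient distance, that is, the distance between orbits in $V$. Compact flat orbifolds are the orbit spaces $V/\Gamma$ of crystallographic groups $\Gamma$. Let $\pi\subset\operatorname{Iso}(\mathbb R^n)$ be a Bieberbach group, let $M_\pi=\mathbb R^n/\pi$ be the corresponding closed flat manifold, and let $P_\pi\colon\mathbb R^n\to M_\pi$ be the projection. Let $H_\pi=\{A:(A,v)\in\pi\text{ for some }v\}\subset\mathsf O(n)$ be its holonomy group and $L_\pi=\{v\in\mathbb R^n:(\mathrm{Id},v)\in\pi\}$ its translation lattice. Let $W\subset\mathbb R^n$ be a linear subspace which is $H_\pi$-invariant and $L_\pi$-generated, i.e., $A(W)\subset W$ for all $A\in H_\pi$, and $W=\operatorname{span}_{\mathbb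 R}(W\cap L_\pi)$. Let $P_{W^\perp}\colon\mathbb R^n\to W^\perp$ be the orthogonal projection, and let $\mathcal F_W$ be the foliation of $M_\pi$ with leaves $\mathcal F_W(u)=P_\pi(W+u)$, $u\in W^\perp$. The leaf space $M_\pi/\mathcal F_W$ is the set of leaves, and the distance between two leaves is the infimum of the distances in $M_\pi$ between their points. \textbf{Theorem.} The map $$\pi\ni(A,v)\longmapsto\big(A|_{W^\perp},\,P_{W^\perp}v\big)\in\operatorname{Iso}(W^\perp)$$ is a well-defined group homomorphism, and its image $\pi^\perp$ is a crystallographic group of $W^\perp$. The distance between leaves is a metric on $M_\pi/\mathcal F_W$, and with this metric $M_\pi/\mathcal F_W$ is isometric to the flat orbifold $W^\perp/\pi^\perp$. -/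

import Mathlib

noncomputable section

namespace FlatCollapse

section Isometries

variable {V : Type*} [NormedAddCommGroup V] [InnerProductSpace ℝ V]

/-- The topology of `Iso(V) = O(V) ⋉ V`: an isometry `x ↦ A x + v` is identified with the
pair `(A, v)`, the translation part being the image of the origin. -/
instance isoTopology : TopologicalSpace (V ≃ᵃⁱ[ℝ] V) :=
  TopologicalSpace.induced
    (fun g : V ≃ᵃⁱ[ℝ] V =>
      ((g.linearIsometryEquiv.toContinuousLinearEquiv : V →L[ℝ] V), g 0))
    inferInstance

/-- The action of `Iso(V)` on `V` by evaluation. -/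
instance isoAction : MulAction (V ≃ᵃⁱ[ℝ] V) V where
  smul g x := g x
  one_smul _ := rfl
  mul_smul _ _ _ := rfl

theorem iso_smul_def (g : V ≃ᵃⁱ[ℝ] V) (x : V) : g • x = g x := rfl

/-- A crystallographic group: a discrete subgroup of `Iso(V)` such that some compact subset
of `V` intersects every orbit. -/
structure IsCrystallographic (Γ : Subgroup (V ≃ᵃⁱ[ℝ] V)) : Prop where
  discrete : DiscreteTopology Γ
  cocompact : ∃ K : Set V, IsCompact K ∧ ∀ x : V, ∃ g ∈ Γ, g x ∈ K

/-- A Bieberbach group: a torsion-free crystallographic group. -/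
structure IsBieberbach (Γ : Subgroup (V ≃ᵃⁱ[ℝ] V)) : Prop extends IsCrystallographic Γ where
  torsionFree : ∀ g ∈ Γ, IsOfFinOrder g → g = 1

/-- The linear part `(A, v) ↦ A`, as a homomorphism from `Iso(V)` to the orthogonal group. -/
def linearPart : (V ≃ᵃⁱ[ℝ] V) →* (V ≃ₗᵢ[ℝ] V) where
  toFun g := g.linearIsometryEquiv
  map_one' := by ext; rfl
  map_mul' _ _ := by ext; rfl

/-- The holonomy group `H_Γ ⊂ O(V)`: the group of linear parts of elements of `Γ`. -/
def holonomyGroup (Γ : Subgroup (V ≃ᵃⁱ[ℝ] V)) : Subgroup (V ≃ₗᵢ[ℝ] V) :=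
  Γ.map linearPart

/-- The lattice `L_Γ ⊂ V`: the vectors `v` whose translation `(Id, v)` belongs to `Γ`, that is,
the kernel of `Γ → H_Γ` regarded as a subgroup of `V`. -/
def translationLattice (Γ : Subgroup (V ≃ᵃⁱ[ℝ] V)) : AddSubgroup V where
  carrier := {v | AffineIsometryEquiv.constVAdd ℝ V v ∈ Γ}
  zero_mem' := by
    have h : AffineIsometryEquiv.constVAdd ℝ V (0 : V) = 1 := by ext x; simp
    simp [h]
  add_mem' := by
    intro a b ha hb
    have h : AffineIsometryEquiv.constVAdd ℝ V (a + b) =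
        AffineIsometryEquiv.constVAdd ℝ V a * AffineIsometryEquiv.constVAdd ℝ V b := by
      ext x; simp [add_assoc]
    simpa only [Set.mem_ofPred_eq, h] using Γ.mul_mem ha hb
  neg_mem' := by
    intro a ha
    have h : AffineIsometryEquiv.constVAdd ℝ V (-a) =
        (AffineIsometryEquiv.constVAdd ℝ V a)⁻¹ := by
      rw [eq_inv_iff_mul_eq_one]; ext x; simp
    simpa only [Set.mem_ofPred_eq, h] using Γ.inv_mem ha

/-- `W` is `H_Γ`-invariant. -/
def IsHolonomyInvariant (Γ : Subgroup (V ≃ᵃⁱ[ℝ] V)) (W : Submodule ℝ V) : Prop :=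
  ∀ A ∈ holonomyGroup Γ, ∀ w ∈ W, A w ∈ W

/-- `W` is `L_Γ`-generated: `W = span_ℝ (W ∩ L_Γ)`. -/
def IsLatticeGenerated (Γ : Subgroup (V ≃ᵃⁱ[ℝ] V)) (W : Submodule ℝ V) : Prop :=
  W = Submodule.span ℝ ((W : Set V) ∩ (translationLattice Γ : Set V))

end Isometries

/-- The distance `inf {d(x, y) : x ∈ A, y ∈ B}` between two (nonempty) subsets. -/
def setDist {X : Type*} [PseudoMetricSpace X] (A B : Set X) : ℝ :=
  sInf (Set.image2 dist A B)

section OrbitSpaces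

variable {V : Type*} [NormedAddCommGroup V] [InnerProductSpace ℝ V]

/-- The orbit space `V/Γ` of a group of isometries. -/
def OrbitSpace (Γ : Subgroup (V ≃ᵃⁱ[ℝ] V)) : Type _ :=
  MulAction.orbitRel.Quotient Γ V

/-- The projection `P_Γ : V → V/Γ`. -/
def OrbitSpace.proj (Γ : Subgroup (V ≃ᵃⁱ[ℝ] V)) (x : V) : OrbitSpace Γ :=
  Quotient.mk (MulAction.orbitRel Γ V) x

theorem OrbitSpace.proj_surjective (Γ : Subgroup (V ≃ᵃⁱ[ℝ] V)) :
    Function.Surjective (OrbitSpace.proj Γ) := Quotient.mk_surjective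

theorem OrbitSpace.proj_eq_iff {Γ : Subgroup (V ≃ᵃⁱ[ℝ] V)} {x y : V} :
    OrbitSpace.proj Γ x = OrbitSpace.proj Γ y ↔ ∃ g ∈ Γ, g y = x := by
  refine (Quotient.eq (r := MulAction.orbitRel Γ V)).trans ?_
  rw [MulAction.orbitRel_apply]
  constructor
  · rintro ⟨⟨g, hg⟩, h⟩
    exact ⟨g, hg, h⟩
  · rintro ⟨g, hg, h⟩
    exact ⟨⟨g, hg⟩, h⟩

/-- The orbit of `V` under `Γ` which is the given point of the orbit space. -/
def OrbitSpace.orbit {Γ : Subgroup (V ≃ᵃⁱ[ℝ] V)} (a : OrbitSpace Γ) : Set V :=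
  {x | OrbitSpace.proj Γ x = a}

theorem OrbitSpace.exists_dist_lt {Γ : Subgroup (V ≃ᵃⁱ[ℝ] V)} (a b : OrbitSpace Γ) {r : ℝ}
    (h : setDist a.orbit b.orbit < r) : ∃ x ∈ a.orbit, ∃ y ∈ b.orbit, dist x y < r := by
  obtain ⟨x, hx⟩ := OrbitSpace.proj_surjective Γ a
  obtain ⟨y, hy⟩ := OrbitSpace.proj_surjective Γ b
  obtain ⟨_, ⟨p, hp, q, hq, rfl⟩, hlt⟩ :=
    exists_lt_of_csInf_lt (s := Set.image2 dist a.orbit b.orbit)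
      ⟨dist x y, Set.mem_image2_of_mem hx hy⟩ h
  exact ⟨p, hp, q, hq, hlt⟩

theorem setDist_le {X : Type*} [PseudoMetricSpace X] {A B : Set X} {x y : X}
    (hx : x ∈ A) (hy : y ∈ B) : setDist A B ≤ dist x y :=
  csInf_le ⟨0, by rintro _ ⟨p, _, q, _, rfl⟩; exact dist_nonneg⟩ (Set.mem_image2_of_mem hx hy)

theorem setDist_nonneg {X : Type*} [PseudoMetricSpace X] (A B : Set X) : 0 ≤ setDist A B :=
  Real.sInf_nonneg (by rintro _ ⟨p, _, q, _, rfl⟩; exact dist_nonneg)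

/-- The quotient distance of the orbit space: the distance between two orbits in `V`. For a
Bieberbach group this is the Riemannian distance of the flat manifold `V/Γ`, and for a
crystallographic group the distance of the flat orbifold `V/Γ`. -/
instance OrbitSpace.instPseudoMetricSpace (Γ : Subgroup (V ≃ᵃⁱ[ℝ] V)) :
    PseudoMetricSpace (OrbitSpace Γ) where
  dist a b := setDist a.orbit b.orbit
  dist_self a := by
    obtain ⟨x, hx⟩ := OrbitSpace.proj_surjective Γ a
    refine le_antisymm ?_ (setDist_nonneg _ _)
    simpa using setDist_le (A := a.orbit) (B := a.orbit) hx hx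
  dist_comm a b := by
    unfold setDist
    rw [Set.image2_swap]
    simp only [dist_comm]
  dist_triangle a b c := by
    refine le_of_forall_pos_le_add fun ε hε => ?_
    obtain ⟨x, hx, y, hy, hxy⟩ := OrbitSpace.exists_dist_lt a b
      (lt_add_of_pos_right (setDist a.orbit b.orbit) (half_pos hε))
    obtain ⟨y', hy', z, hz, hyz⟩ := OrbitSpace.exists_dist_lt b c
      (lt_add_of_pos_right (setDist b.orbit c.orbit) (half_pos hε))
    obtain ⟨g, hg, hgy⟩ := OrbitSpace.proj_eq_iff.1
      ((show OrbitSpace.proj Γ y = b from hy).trans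
        (show OrbitSpace.proj Γ y' = b from hy').symm)
    have hgz : g z ∈ c.orbit :=
      (OrbitSpace.proj_eq_iff.2 ⟨g, hg, rfl⟩).trans (show OrbitSpace.proj Γ z = c from hz)
    have h1 : setDist a.orbit c.orbit ≤ dist x (g z) := setDist_le hx hgz
    have h2 : dist x (g z) ≤ dist x y + dist y (g z) := dist_triangle _ _ _
    have h3 : dist y (g z) = dist y' z := by rw [← hgy]; exact g.dist_map y' z
    linarith

end OrbitSpaces

section Foliation

variable {V : Type*} [NormedAddCommGroup V] [InnerProductSpace ℝ V]

/-- The leaf `F_W(u) = P_Γ(W + u)` of the subspace foliation of `V/Γ` defined by `W`. -/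
def leaf (Γ : Subgroup (V ≃ᵃⁱ[ℝ] V)) (W : Submodule ℝ V) (u : V) : Set (OrbitSpace Γ) :=
  OrbitSpace.proj Γ '' {x | ∃ w ∈ W, x = w + u}

/-- The leaf space `(V/Γ)/F_W`: its points are the leaves `F_W(u)`, `u ∈ W^⊥`. -/
def LeafSpace (Γ : Subgroup (V ≃ᵃⁱ[ℝ] V)) (W : Submodule ℝ V) : Type _ :=
  {F : Set (OrbitSpace Γ) // ∃ u ∈ Wᗮ, F = leaf Γ W u}

/-- The distance between two leaves, as subsets of `V/Γ`. -/
def leafDist {Γ : Subgroup (V ≃ᵃⁱ[ℝ] V)} {W : Submodule ℝ V} (F F' : LeafSpace Γ W) : ℝ :=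
  setDist F.1 F'.1

end Foliation

end FlatCollapse

end

/-! Linear parts of elements of `π` preserve `W`, hence `Wᗮ`, so orthogonal projection to `Wᗮ`
carries the action of `π` to an isometric action on `Wᗮ`. A compact set meeting all orbits projects
to one.

Discreteness of the image is where lattice generation enters. Translations in `W` along the lattice
act trivially on `Wᗮ`, so an image element near the identity has a preimage moving the origin by a
bounded amount. A discrete group has only finitely many such elements
(`finite_setOf_norm_apply_zero_le`), so the identity is isolated.

The leaves are the fibres of the induced map on orbit spaces (`leaf_eq_preimage`). That map is
1-Lipschitz and the inclusion of `Wᗮ` realises distances, so fibre distance equals base distance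
(`setDist_preimage_orbitSpaceProjection`). Discreteness of the image makes the base distance
definite. -/

noncomputable section

namespace FlatCollapse

/-! ### Discrete groups of isometries and their orbit spaces -/

section Discreteness

variable {V : Type*} [NormedAddCommGroup V] [InnerProductSpace ℝ V]

/-- The pair `(A, v)` describing the isometry `x ↦ A x + v`. -/
def isoCoord (g : V ≃ᵃⁱ[ℝ] V) : (V →L[ℝ] V) × V :=
  ((g.linearIsometryEquiv.toContinuousLinearEquiv : V →L[ℝ] V), g 0)

theorem isInducing_isoCoord : Topology.IsInducing (isoCoord (V := V)) := ⟨rfl⟩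

theorem iso_apply_eq (g : V ≃ᵃⁱ[ℝ] V) (x : V) : g x = g.linearIsometryEquiv x + g 0 := by
  simpa using g.map_vadd 0 x

theorem linearIsometryEquiv_apply_eq (g : V ≃ᵃⁱ[ℝ] V) (x : V) :
    g.linearIsometryEquiv x = g x - g 0 :=
  eq_sub_of_add_eq (iso_apply_eq g x).symm

theorem linearIsometryEquiv_inv_mul_apply (g h : V ≃ᵃⁱ[ℝ] V) (x : V) :
    g.linearIsometryEquiv ((g⁻¹ * h).linearIsometryEquiv x) = h.linearIsometryEquiv x := by
  have h1 : linearPart g * linearPart (g⁻¹ * h) = linearPart h := by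
    rw [← map_mul, mul_inv_cancel_left]
  exact congrArg (fun A : V ≃ₗᵢ[ℝ] V => A x) h1

/-- Composing with `g` on the left changes neither operator-norm nor point distances. Thus a gap at
the identity separates all elements of a group uniformly. -/
theorem dist_isoCoord_inv_mul_one_le (g h : V ≃ᵃⁱ[ℝ] V) :
    dist (isoCoord (g⁻¹ * h)) (isoCoord 1) ≤ dist (isoCoord h) (isoCoord g) := by
  rw [Prod.dist_eq, Prod.dist_eq]
  refine max_le_max ?_ (le_of_eq ?_)
  · rw [dist_eq_norm, dist_eq_norm]
    refine ContinuousLinearMap.opNorm_le_bound _ (norm_nonneg _) fun x => ?_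
    refine le_of_eq_of_le ?_ (ContinuousLinearMap.le_opNorm _ x)
    change ‖(g⁻¹ * h).linearIsometryEquiv x - x‖ =
      ‖h.linearIsometryEquiv x - g.linearIsometryEquiv x‖
    rw [← linearIsometryEquiv_inv_mul_apply g h x, ← map_sub, LinearIsometryEquiv.norm_map]
  · change dist (g⁻¹ (h 0)) 0 = dist (h 0) (g 0)
    rw [← g.dist_map (g⁻¹ (h 0)) 0]
    congr 1
    exact g.apply_symm_apply _

theorem discreteTopology_iff_exists_forall_dist_isoCoord {Γ : Subgroup (V ≃ᵃⁱ[ℝ] V)} :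
    DiscreteTopology Γ ↔
      ∃ ε > 0, ∀ g ∈ Γ, dist (isoCoord g) (isoCoord 1) < ε → g = 1 := by
  have hind : Topology.IsInducing fun g : Γ => isoCoord (g : V ≃ᵃⁱ[ℝ] V) :=
    isInducing_isoCoord.comp Topology.IsInducing.subtypeVal
  constructor
  · intro _
    have h1 : ({1} : Set Γ) ∈ nhds (1 : Γ) := (isOpen_discrete _).mem_nhds rfl
    rw [hind.nhds_eq_comap] at h1
    obtain ⟨t, ht, hsub⟩ := h1
    obtain ⟨ε, hε, hball⟩ := Metric.mem_nhds_iff.1 ht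
    refine ⟨ε, hε, fun g hg hlt => ?_⟩
    have h2 : (⟨g, hg⟩ : Γ) ∈ ({1} : Set Γ) := hsub (hball hlt)
    exact congrArg Subtype.val (Set.mem_singleton_iff.1 h2)
  · rintro ⟨ε, hε, h⟩
    refine discreteTopology_iff_isOpen_singleton.2 fun g => ?_
    rw [isOpen_iff_mem_nhds]
    rintro _ rfl
    rw [hind.nhds_eq_comap]
    rename_i g
    refine ⟨Metric.ball (isoCoord (g : V ≃ᵃⁱ[ℝ] V)) ε, Metric.ball_mem_nhds _ hε, fun k hk => ?_⟩
    have h1 := h _ (Γ.mul_mem (Γ.inv_mem g.2) k.2)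
      ((dist_isoCoord_inv_mul_one_le _ _).trans_lt hk)
    exact Subtype.ext (inv_mul_eq_one.1 h1).symm

/-- A discrete group of isometries of a finite-dimensional space acts properly. -/
theorem finite_setOf_norm_apply_zero_le [FiniteDimensional ℝ V] (Γ : Subgroup (V ≃ᵃⁱ[ℝ] V))
    [hΓ : DiscreteTopology Γ] (R : ℝ) : {g | g ∈ Γ ∧ ‖g 0‖ ≤ R}.Finite := by
  obtain ⟨ε, hε, h⟩ := discreteTopology_iff_exists_forall_dist_isoCoord.1 hΓ
  have : ProperSpace ((V →L[ℝ] V) × V) := FiniteDimensional.proper ℝ _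
  -- Linear parts have norm at most 1, hence the radius. Radius `ε / 2` forces elements sharing a
  -- centre to coincide.
  obtain ⟨t, ht, hcover⟩ := Metric.totallyBounded_iff.1
    (isCompact_closedBall (0 : (V →L[ℝ] V) × V) (max 1 R)).totallyBounded (ε / 2) (half_pos hε)
  have hmem : ∀ g ∈ {g | g ∈ Γ ∧ ‖g 0‖ ≤ R}, ∃ y ∈ t, dist (isoCoord g) y < ε / 2 := by
    intro g hg
    have h1 : isoCoord g ∈ Metric.closedBall (0 : (V →L[ℝ] V) × V) (max 1 R) := by
      rw [mem_closedBall_zero_iff, Prod.norm_def]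
      refine max_le_max ?_ hg.2
      exact ContinuousLinearMap.opNorm_le_bound _ zero_le_one fun x => by
        rw [one_mul]; exact (g.linearIsometryEquiv.norm_map x).le
    simpa using hcover h1
  choose! c hc hdist using hmem
  refine Set.Finite.of_injOn hc (fun g hg k hk hgk => ?_) ht
  refine inv_mul_eq_one.1 (h _ (Γ.mul_mem (Γ.inv_mem hg.1) hk.1)
    ((dist_isoCoord_inv_mul_one_le _ _).trans_lt ?_))
  have h1 := hdist g hg
  have h2 := hdist k hk
  rw [← hgk] at h2
  linarith [dist_triangle_right (isoCoord k) (isoCoord g) (c g)]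

/-- Only finitely many group elements bring `y` within 1 of `x`, and a finite set of points is
closed, so a zero infimum is attained. -/
theorem eq_of_dist_orbitSpace_eq_zero [FiniteDimensional ℝ V]
    (Γ : Subgroup (V ≃ᵃⁱ[ℝ] V)) [DiscreteTopology Γ] {a b : OrbitSpace Γ} (h : dist a b = 0) :
    a = b := by
  obtain ⟨x, rfl⟩ := OrbitSpace.proj_surjective Γ a
  obtain ⟨y, rfl⟩ := OrbitSpace.proj_surjective Γ b
  have hsmall : ∀ r > 0, ∃ g ∈ Γ, dist x (g y) < r := by
    intro r hr
    obtain ⟨p, hp, q, hq, hpq⟩ := OrbitSpace.exists_dist_lt _ _ (h.trans_lt hr)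
    obtain ⟨k, hk, hkp⟩ := OrbitSpace.proj_eq_iff.1 (Eq.symm hp)
    obtain ⟨l, hl, hlq⟩ := OrbitSpace.proj_eq_iff.1 hq
    refine ⟨k * l, Γ.mul_mem hk hl, ?_⟩
    rw [← hkp, AffineIsometryEquiv.coe_mul, Function.comp_apply, hlq, k.dist_map]
    exact hpq
  have hfin : ((fun g : V ≃ᵃⁱ[ℝ] V => g y) '' {g | g ∈ Γ ∧ ‖g 0‖ ≤ ‖y‖ + 1 + ‖x‖}).Finite :=
    (finite_setOf_norm_apply_zero_le Γ _).image _
  have hx : x ∈ (fun g : V ≃ᵃⁱ[ℝ] V => g y) '' {g | g ∈ Γ ∧ ‖g 0‖ ≤ ‖y‖ + 1 + ‖x‖} := by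
    rw [← hfin.isClosed.closure_eq, Metric.mem_closure_iff]
    intro r hr
    obtain ⟨g, hg, hlt⟩ := hsmall (min r 1) (lt_min hr one_pos)
    refine ⟨_, ⟨g, ⟨hg, ?_⟩, rfl⟩, hlt.trans_le (min_le_left _ _)⟩
    have h1 : dist (g 0) (g y) = ‖y‖ := by rw [g.dist_map, dist_zero_left]
    have h2 := dist_triangle4 (g 0) (g y) x 0
    rw [dist_zero_right, dist_zero_right, h1, dist_comm (g y)] at h2
    linarith [hlt.trans_le (min_le_right _ _)]
  obtain ⟨g, hg, hgx⟩ := hx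
  exact OrbitSpace.proj_eq_iff.2 ⟨g, hg.1, hgx⟩

end Discreteness

/-! ### Approximating a span by lattice points -/

section Lattice

/-- A real vector space spanned by a subgroup lies in a bounded neighbourhood of it. -/
theorem exists_forall_mem_span_exists_norm_sub_le {V : Type*} [NormedAddCommGroup V]
    [NormedSpace ℝ V] [FiniteDimensional ℝ V] (L : AddSubgroup V) :
    ∃ R : ℝ, ∀ w ∈ Submodule.span ℝ (L : Set V), ∃ l ∈ L, ‖w - l‖ ≤ R := by
  obtain ⟨t, htL, ht⟩ := (Submodule.fg_span_iff_fg_span_finset_subset (R := ℝ) (L : Set V)).1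
    (IsNoetherian.noetherian _)
  refine ⟨∑ i ∈ t, ‖i‖, fun w hw => ?_⟩
  rw [ht] at hw
  obtain ⟨c, -, rfl⟩ := Submodule.mem_span_finset.1 hw
  -- Rounding each coefficient down costs at most `‖i‖` per generator.
  refine ⟨∑ i ∈ t, ⌊c i⌋ • i, L.sum_mem fun i hi => L.zsmul_mem (htL hi) _, ?_⟩
  rw [← Finset.sum_sub_distrib]
  refine norm_sum_le_of_le t fun i _ => ?_
  rw [← Int.cast_smul_eq_zsmul ℝ, ← sub_smul, norm_smul, Real.norm_eq_abs, Int.self_sub_floor,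
    abs_of_nonneg (Int.fract_nonneg _)]
  exact mul_le_of_le_one_left (norm_nonneg _) (Int.fract_lt_one _).le

end Lattice

/-! ### The induced crystallographic group on the orthogonal complement -/

section Projection

variable {V : Type*} [NormedAddCommGroup V] [InnerProductSpace ℝ V]
  {Γ : Subgroup (V ≃ᵃⁱ[ℝ] V)} {W : Submodule ℝ V}

theorem IsHolonomyInvariant.linearIsometryEquiv_mem (hW : IsHolonomyInvariant Γ W)
    {g : V ≃ᵃⁱ[ℝ] V} (hg : g ∈ Γ) {w : V} (hw : w ∈ W) : g.linearIsometryEquiv w ∈ W :=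
  hW _ ⟨g, hg, rfl⟩ w hw

theorem IsHolonomyInvariant.linearIsometryEquiv_mem_orthogonal (hW : IsHolonomyInvariant Γ W)
    {g : V ≃ᵃⁱ[ℝ] V} (hg : g ∈ Γ) {u : V} (hu : u ∈ Wᗮ) : g.linearIsometryEquiv u ∈ Wᗮ := by
  rw [Submodule.mem_orthogonal] at hu ⊢
  intro w hw
  have h1 : g.linearIsometryEquiv (g⁻¹.linearIsometryEquiv w) = w := by
    rw [← mul_one g⁻¹]
    exact linearIsometryEquiv_inv_mul_apply g 1 w
  rw [← h1, LinearIsometryEquiv.inner_map_map]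
  exact hu _ (hW.linearIsometryEquiv_mem (Γ.inv_mem hg) hw)

variable [FiniteDimensional ℝ V]

theorem orthogonalProjectionOnto_add_of_mem {w : V} (hw : w ∈ W) (x : V) :
    Wᗮ.orthogonalProjectionOnto (w + x) = Wᗮ.orthogonalProjectionOnto x := by
  rw [map_add, Submodule.orthogonalProjectionOnto_eq_zero_iff.2 (W.le_orthogonal_orthogonal hw),
    zero_add]

theorem sub_orthogonalProjectionOnto_orthogonal_mem (x : V) :
    x - Wᗮ.orthogonalProjectionOnto x ∈ W := by
  simp

/-- The discarded component lies in `W`, and the linear part of `g` keeps it there. This gives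
multiplicativity of `orthogonalHom` and equivariance of the projection. -/
theorem IsHolonomyInvariant.projection_apply_projection (hW : IsHolonomyInvariant Γ W)
    {g : V ≃ᵃⁱ[ℝ] V} (hg : g ∈ Γ) (x : V) :
    Wᗮ.orthogonalProjectionOnto (g (Wᗮ.orthogonalProjectionOnto x)) =
      Wᗮ.orthogonalProjectionOnto (g x) := by
  rw [← orthogonalProjectionOnto_add_of_mem (hW.linearIsometryEquiv_mem hg
    (sub_orthogonalProjectionOnto_orthogonal_mem x)) (g _), iso_apply_eq g x, iso_apply_eq g,
    ← add_assoc, ← map_add, sub_add_cancel]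

theorem IsHolonomyInvariant.dist_projection_apply (hW : IsHolonomyInvariant Γ W)
    {g : V ≃ᵃⁱ[ℝ] V} (hg : g ∈ Γ) (u u' : Wᗮ) :
    dist (Wᗮ.orthogonalProjectionOnto (g u)) (Wᗮ.orthogonalProjectionOnto (g u')) = dist u u' := by
  have h1 : g u - g u' ∈ Wᗮ := by
    rw [iso_apply_eq g u, iso_apply_eq g u', add_sub_add_right_eq_sub, ← map_sub]
    exact hW.linearIsometryEquiv_mem_orthogonal hg (u - u').2
  rw [dist_eq_norm, ← map_sub]
  exact (congrArg norm (Wᗮ.orthogonalProjectionOnto_mem_subspace_eq_self ⟨_, h1⟩)).trans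
    ((dist_eq_norm (g u) (g u')).symm.trans (g.dist_map u u'))

/-- The isometry `(A|_{W^⊥}, P_{W^⊥} v)` of `W^⊥` induced by an element `(A, v)` of `Γ`. -/
def orthogonalIso (hW : IsHolonomyInvariant Γ W) (g : Γ) : Wᗮ ≃ᵃⁱ[ℝ] Wᗮ :=
  -- By Mazur–Ulam, a bijective isometry is automatically affine.
  IsometryEquiv.toRealAffineIsometryEquiv <|
    IsometryEquiv.mk' (fun u => Wᗮ.orthogonalProjectionOnto ((g : V ≃ᵃⁱ[ℝ] V) u))
      (fun u => Wᗮ.orthogonalProjectionOnto ((g : V ≃ᵃⁱ[ℝ] V)⁻¹ u))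
      (fun u => by
        rw [hW.projection_apply_projection g.2]
        exact (congrArg _ ((g : V ≃ᵃⁱ[ℝ] V).apply_symm_apply _)).trans
          (Wᗮ.orthogonalProjectionOnto_mem_subspace_eq_self u))
      (Isometry.of_dist_eq fun u u' => hW.dist_projection_apply g.2 u u')

/-- The homomorphism `Γ → Iso(W^⊥)`, `(A, v) ↦ (A|_{W^⊥}, P_{W^⊥} v)`. -/
def orthogonalHom (hW : IsHolonomyInvariant Γ W) : Γ →* (Wᗮ ≃ᵃⁱ[ℝ] Wᗮ) where
  toFun := orthogonalIso hW
  map_one' := AffineIsometryEquiv.ext fun u =>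
    Wᗮ.orthogonalProjectionOnto_mem_subspace_eq_self u
  map_mul' g h := AffineIsometryEquiv.ext fun u =>
    (hW.projection_apply_projection g.2 ((h : V ≃ᵃⁱ[ℝ] V) u)).symm

theorem orthogonalHom_apply (hW : IsHolonomyInvariant Γ W) (g : Γ) (u : Wᗮ) :
    orthogonalHom hW g u = Wᗮ.orthogonalProjectionOnto ((g : V ≃ᵃⁱ[ℝ] V) u) := rfl

theorem orthogonalHom_apply_projection (hW : IsHolonomyInvariant Γ W) (g : Γ) (x : V) :
    orthogonalHom hW g (Wᗮ.orthogonalProjectionOnto x) =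
      Wᗮ.orthogonalProjectionOnto ((g : V ≃ᵃⁱ[ℝ] V) x) :=
  hW.projection_apply_projection g.2 x

theorem orthogonalHom_apply_zero (hW : IsHolonomyInvariant Γ W) (g : Γ) :
    orthogonalHom hW g 0 = Wᗮ.orthogonalProjectionOnto ((g : V ≃ᵃⁱ[ℝ] V) 0) := rfl

theorem coe_linearIsometryEquiv_orthogonalHom (hW : IsHolonomyInvariant Γ W) (g : Γ) (u : Wᗮ) :
    ((orthogonalHom hW g).linearIsometryEquiv u : V) =
      (g : V ≃ᵃⁱ[ℝ] V).linearIsometryEquiv u := by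
  rw [linearIsometryEquiv_apply_eq, orthogonalHom_apply, orthogonalHom_apply_zero, ← map_sub,
    ← linearIsometryEquiv_apply_eq]
  exact congrArg Subtype.val (Wᗮ.orthogonalProjectionOnto_mem_subspace_eq_self
    ⟨_, hW.linearIsometryEquiv_mem_orthogonal g.2 u.2⟩)

theorem orthogonalHom_constVAdd_mul (hW : IsHolonomyInvariant Γ W) {l : V} (hl : l ∈ W)
    (hl' : l ∈ translationLattice Γ) (g : Γ) :
    orthogonalHom hW (⟨AffineIsometryEquiv.constVAdd ℝ V l, hl'⟩ * g) = orthogonalHom hW g :=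
  AffineIsometryEquiv.ext fun u => orthogonalProjectionOnto_add_of_mem hl ((g : V ≃ᵃⁱ[ℝ] V) u)

theorem discreteTopology_range_orthogonalHom [DiscreteTopology Γ] (hW : IsHolonomyInvariant Γ W)
    (hgen : IsLatticeGenerated Γ W) : DiscreteTopology (orthogonalHom hW).range := by
  obtain ⟨R, hR⟩ := exists_forall_mem_span_exists_norm_sub_le
    (W.toAddSubgroup ⊓ translationLattice Γ)
  have hR' : ∀ w ∈ W, ∃ l ∈ W, l ∈ translationLattice Γ ∧ ‖w - l‖ ≤ R := by
    intro w hw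
    rw [hgen] at hw
    obtain ⟨l, hl, hle⟩ := hR w hw
    exact ⟨l, hl.1, hl.2, hle⟩
  -- With the identity's coordinates removed, the complement of this finite set is a neighbourhood
  -- of them.
  have hfin : (isoCoord ∘ orthogonalHom hW ''
      {g : Γ | ‖(g : V ≃ᵃⁱ[ℝ] V) 0‖ ≤ R + 1} \ {isoCoord 1}).Finite := by
    refine (Set.Finite.image _ ?_).sdiff
    refine Set.Finite.of_finite_image ((finite_setOf_norm_apply_zero_le Γ (R + 1)).subset ?_)
      Subtype.val_injective.injOn
    rintro _ ⟨g, hg, rfl⟩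
    exact ⟨g.2, hg⟩
  obtain ⟨ε, hε, hball⟩ := Metric.isOpen_iff.1 hfin.isClosed.isOpen_compl (isoCoord 1)
    fun h => h.2 rfl
  refine discreteTopology_iff_exists_forall_dist_isoCoord.2
    ⟨min ε 1, lt_min hε one_pos, ?_⟩
  rintro _ ⟨g, rfl⟩ hlt
  obtain ⟨l, hlW, hlL, hle⟩ := hR' _
    (sub_orthogonalProjectionOnto_orthogonal_mem ((g : V ≃ᵃⁱ[ℝ] V) 0))
  -- `k` has the same image as `g`, but the `W`-component of `k 0` has norm at most `R`; the other
  -- component is below 1 by the `min ε 1`.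
  set k : Γ := ⟨AffineIsometryEquiv.constVAdd ℝ V (-l), (translationLattice Γ).neg_mem hlL⟩ * g
    with hk
  have hkg : orthogonalHom hW k = orthogonalHom hW g :=
    orthogonalHom_constVAdd_mul hW (W.neg_mem hlW) _ g
  have hsmall : ‖Wᗮ.orthogonalProjectionOnto ((g : V ≃ᵃⁱ[ℝ] V) 0)‖ < 1 := by
    rw [← orthogonalHom_apply_zero hW, ← dist_zero_right]
    exact (le_max_right _ _).trans_lt (hlt.trans_le (min_le_right _ _))
  have hk0 : ‖(k : V ≃ᵃⁱ[ℝ] V) 0‖ ≤ R + 1 := by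
    have h1 : (k : V ≃ᵃⁱ[ℝ] V) 0 =
        ((g : V ≃ᵃⁱ[ℝ] V) 0 - Wᗮ.orthogonalProjectionOnto ((g : V ≃ᵃⁱ[ℝ] V) 0) - l) +
          Wᗮ.orthogonalProjectionOnto ((g : V ≃ᵃⁱ[ℝ] V) 0) := by
      change -l + (g : V ≃ᵃⁱ[ℝ] V) 0 = _
      abel
    rw [h1]
    exact (norm_add_le _ _).trans (add_le_add hle hsmall.le)
  by_contra hne
  refine hball (hlt.trans_le (min_le_left _ _)) ⟨⟨k, hk0, congrArg isoCoord hkg⟩, fun h => hne ?_⟩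
  have h2 := congrArg Prod.snd (Set.mem_singleton_iff.1 h)
  have h3 := congrArg Prod.fst (Set.mem_singleton_iff.1 h)
  refine AffineIsometryEquiv.ext fun u => ?_
  rw [iso_apply_eq, iso_apply_eq 1]
  exact congrArg₂ (· + ·) (DFunLike.congr_fun h3 u) h2

theorem isCrystallographic_range_orthogonalHom (hΓ : IsCrystallographic Γ)
    (hW : IsHolonomyInvariant Γ W) (hgen : IsLatticeGenerated Γ W) :
    IsCrystallographic (orthogonalHom hW).range where
  discrete := by
    have := hΓ.discrete
    exact discreteTopology_range_orthogonalHom hW hgen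
  cocompact := by
    obtain ⟨K, hK, h⟩ := hΓ.cocompact
    refine ⟨Wᗮ.orthogonalProjectionOnto '' K,
      hK.image Wᗮ.orthogonalProjectionOnto.continuous, fun u => ?_⟩
    obtain ⟨g, hg, hgu⟩ := h u
    exact ⟨_, ⟨⟨g, hg⟩, rfl⟩, _, hgu, rfl⟩

end Projection

/-! ### Leaves as fibres, and their distances -/

section Leaves

variable {V : Type*} [NormedAddCommGroup V] [InnerProductSpace ℝ V] [FiniteDimensional ℝ V]
  {Γ : Subgroup (V ≃ᵃⁱ[ℝ] V)} {W : Submodule ℝ V}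

/-- The map `V/Γ → W^⊥/Γ^⊥` induced by the orthogonal projection `V → W^⊥`. -/
def orbitSpaceProjection (hW : IsHolonomyInvariant Γ W) (a : OrbitSpace Γ) :
    OrbitSpace (orthogonalHom hW).range :=
  Quotient.liftOn a (fun x => OrbitSpace.proj _ (Wᗮ.orthogonalProjectionOnto x)) <| by
    intro x y hxy
    obtain ⟨g, hg, rfl⟩ := OrbitSpace.proj_eq_iff.1 (Quotient.sound hxy)
    exact OrbitSpace.proj_eq_iff.2
      ⟨_, ⟨⟨g, hg⟩, rfl⟩, orthogonalHom_apply_projection hW ⟨g, hg⟩ y⟩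

theorem orbitSpaceProjection_proj (hW : IsHolonomyInvariant Γ W) (x : V) :
    orbitSpaceProjection hW (OrbitSpace.proj Γ x) =
      OrbitSpace.proj _ (Wᗮ.orthogonalProjectionOnto x) := rfl

theorem orbitSpaceProjection_proj_coe (hW : IsHolonomyInvariant Γ W) (u : Wᗮ) :
    orbitSpaceProjection hW (OrbitSpace.proj Γ u) = OrbitSpace.proj _ u := by
  rw [orbitSpaceProjection_proj, Submodule.orthogonalProjectionOnto_mem_subspace_eq_self]

theorem orbitSpaceProjection_surjective (hW : IsHolonomyInvariant Γ W) :
    Function.Surjective (orbitSpaceProjection hW) := by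
  intro b
  obtain ⟨u, rfl⟩ := OrbitSpace.proj_surjective _ b
  exact ⟨_, orbitSpaceProjection_proj_coe hW u⟩

/-- If the projection of `x` is equivalent to `u`, a lift to `Γ` of the element relating them moves
`x` into `W + u`. -/
theorem leaf_eq_preimage (hW : IsHolonomyInvariant Γ W) (u : Wᗮ) :
    leaf Γ W u = orbitSpaceProjection hW ⁻¹' {OrbitSpace.proj _ u} := by
  ext a
  constructor
  · rintro ⟨_, ⟨w, hw, rfl⟩, rfl⟩
    rw [Set.mem_preimage, orbitSpaceProjection_proj, orthogonalProjectionOnto_add_of_mem hw,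
      Submodule.orthogonalProjectionOnto_mem_subspace_eq_self]
    rfl
  · obtain ⟨x, rfl⟩ := OrbitSpace.proj_surjective Γ a
    intro h
    obtain ⟨_, ⟨g, rfl⟩, hg⟩ := OrbitSpace.proj_eq_iff.1 (Eq.symm h)
    rw [orthogonalHom_apply_projection] at hg
    refine ⟨(g : V ≃ᵃⁱ[ℝ] V) x,
      ⟨_, sub_orthogonalProjectionOnto_orthogonal_mem ((g : V ≃ᵃⁱ[ℝ] V) x), ?_⟩,
      OrbitSpace.proj_eq_iff.2 ⟨g, g.2, rfl⟩⟩
    rw [← hg, sub_add_cancel]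

theorem dist_orbitSpaceProjection_le (hW : IsHolonomyInvariant Γ W) (a a' : OrbitSpace Γ) :
    dist (orbitSpaceProjection hW a) (orbitSpaceProjection hW a') ≤ dist a a' := by
  refine le_of_forall_gt fun r hr => ?_
  obtain ⟨x, rfl, y, rfl, hxy⟩ := OrbitSpace.exists_dist_lt a a' hr
  refine lt_of_le_of_lt (setDist_le rfl rfl) (lt_of_le_of_lt ?_ hxy)
  rw [dist_eq_norm, dist_eq_norm, ← map_sub]
  exact Wᗮ.norm_orthogonalProjectionOnto_apply_le _

theorem setDist_preimage_orbitSpaceProjection (hW : IsHolonomyInvariant Γ W)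
    (b c : OrbitSpace (orthogonalHom hW).range) :
    setDist (orbitSpaceProjection hW ⁻¹' {b}) (orbitSpaceProjection hW ⁻¹' {c}) = dist b c := by
  apply le_antisymm
  -- Nearby representatives in `Wᗮ`, viewed in `V`, give points of the two fibres at least as close.
  · refine le_of_forall_gt fun r hr => ?_
    obtain ⟨u, rfl, v, rfl, huv⟩ := OrbitSpace.exists_dist_lt b c hr
    refine lt_of_le_of_lt (setDist_le (orbitSpaceProjection_proj_coe hW u)
      (orbitSpaceProjection_proj_coe hW v)) (lt_of_le_of_lt (setDist_le rfl rfl) huv)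
  · obtain ⟨a, ha⟩ := orbitSpaceProjection_surjective hW b
    obtain ⟨a', ha'⟩ := orbitSpaceProjection_surjective hW c
    refine le_csInf ⟨_, Set.mem_image2_of_mem ha ha'⟩ ?_
    rintro _ ⟨p, rfl, q, rfl, rfl⟩
    exact dist_orbitSpaceProjection_le hW p q

/-- The bijection between `W^⊥/Γ^⊥` and the leaf space, a point corresponding to its preimage
in `V/Γ`. -/
def orbitSpaceEquivLeafSpace (hW : IsHolonomyInvariant Γ W) :
    OrbitSpace (orthogonalHom hW).range ≃ LeafSpace Γ W :=
  Equiv.ofBijective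
    (fun b => ⟨orbitSpaceProjection hW ⁻¹' {b}, by
      obtain ⟨u, rfl⟩ := OrbitSpace.proj_surjective _ b
      exact ⟨u, u.2, (leaf_eq_preimage hW u).symm⟩⟩)
    ⟨fun b c h => Set.singleton_injective
        ((orbitSpaceProjection_surjective hW).preimage_injective (congrArg Subtype.val h)),
      fun ⟨_, u, hu, hF⟩ => ⟨OrbitSpace.proj _ ⟨u, hu⟩,
        Subtype.ext ((leaf_eq_preimage hW ⟨u, hu⟩).symm.trans hF.symm)⟩⟩

theorem leafDist_orbitSpaceEquivLeafSpace (hW : IsHolonomyInvariant Γ W)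
    (b c : OrbitSpace (orthogonalHom hW).range) :
    leafDist (orbitSpaceEquivLeafSpace hW b) (orbitSpaceEquivLeafSpace hW c) = dist b c :=
  setDist_preimage_orbitSpaceProjection hW b c

end Leaves

end FlatCollapse

end

theorem mainTheorem4 (n : ℕ)
    (π : Subgroup (EuclideanSpace ℝ (Fin n) ≃ᵃⁱ[ℝ] EuclideanSpace ℝ (Fin n)))
    (hπ : FlatCollapse.IsBieberbach π)
    (W : Submodule ℝ (EuclideanSpace ℝ (Fin n)))
    (hWinv : FlatCollapse.IsHolonomyInvariant π W)
    (hWgen : FlatCollapse.IsLatticeGenerated π W) :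
    ∃ φ : π →* (Wᗮ ≃ᵃⁱ[ℝ] Wᗮ),
      (∀ (g : π) (u : Wᗮ),
        (((φ g).linearIsometryEquiv u : Wᗮ) : EuclideanSpace ℝ (Fin n)) =
          (g : EuclideanSpace ℝ (Fin n) ≃ᵃⁱ[ℝ] EuclideanSpace ℝ (Fin n)).linearIsometryEquiv u) ∧
      (∀ g : π, φ g 0 = Wᗮ.orthogonalProjectionOnto
        ((g : EuclideanSpace ℝ (Fin n) ≃ᵃⁱ[ℝ] EuclideanSpace ℝ (Fin n)) 0)) ∧
      FlatCollapse.IsCrystallographic φ.range ∧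
      ∃ _ : MetricSpace (FlatCollapse.LeafSpace π W),
        (∀ F F' : FlatCollapse.LeafSpace π W, dist F F' = FlatCollapse.leafDist F F') ∧
        Nonempty (FlatCollapse.LeafSpace π W ≃ᵢ FlatCollapse.OrbitSpace φ.range) := by
  have hcryst := FlatCollapse.isCrystallographic_range_orthogonalHom
    hπ.toIsCrystallographic hWinv hWgen
  have hdisc := hcryst.discrete
  let e := FlatCollapse.orbitSpaceEquivLeafSpace hWinv
  let orbitMetric : MetricSpace
      (FlatCollapse.OrbitSpace (FlatCollapse.orthogonalHom hWinv).range) :=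
    { FlatCollapse.OrbitSpace.instPseudoMetricSpace _ with
      eq_of_dist_eq_zero := FlatCollapse.eq_of_dist_orbitSpace_eq_zero _ }
  -- Transporting the metric along `e` makes the isometry definitional; only agreement with
  -- `leafDist` remains.
  let leafMetric : MetricSpace (FlatCollapse.LeafSpace π W) :=
    MetricSpace.induced e.symm e.symm.injective orbitMetric
  refine ⟨FlatCollapse.orthogonalHom hWinv,
    FlatCollapse.coe_linearIsometryEquiv_orthogonalHom hWinv,
    FlatCollapse.orthogonalHom_apply_zero hWinv, hcryst, leafMetric, fun F F' => ?_,
    ⟨⟨e.symm, Isometry.of_dist_eq fun _ _ => rfl⟩⟩⟩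
  have h := FlatCollapse.leafDist_orbitSpaceEquivLeafSpace hWinv (e.symm F) (e.symm F')
  rw [e.apply_symm_apply, e.apply_symm_apply] at h
  exact h.symm
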